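/- An open set $\Omega\subseteq\mathbb{C}^n$ is called a domain of holomorphy if there do not exist open sets $W,V\subseteq\mathbb{C}^n$ with $\emptyset\neq W\subseteq V\cap\Omega$ and with $V$ connected and not contained in $\Omega$, such that for every holomorphic function $f$ on $\Omega$ there is a holomorphic function $g$ on $V$ with $f=g$ on $W$. Theorem. Let $n\geq 2$ and let $\Omega\subset\mathbb{C}^n$ be a nonempty, connected, bounded domain of holomorphy. Then the topological boundary $\partial\Omega$ of $\Omega$ in $\mathbb{C}^n$ is connected. -/

import Mathlib

/-- A set `Ω ⊆ ℂⁿ` is a domain of holomorphy if it is open and there do not exist open sets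
`W` and `V` with `∅ ≠ W ⊆ V ∩ Ω`, with `V` connected and not contained in `Ω`, such that for every
holomorphic function `f` on `Ω` there is a holomorphic function `g` on `V` with `f = g` on `W`.
On open sets, holomorphic means complex (Fréchet) differentiable at every point.
Connectedness of `Ω` is not part of the definition. -/
structure IsDomainOfHolomorphy {n : ℕ} (Ω : Set (EuclideanSpace ℂ (Fin n))) : Prop where
  isOpen : IsOpen Ω
  not_extends : ¬ ∃ W V : Set (EuclideanSpace ℂ (Fin n)),
    IsOpen W ∧ W.Nonempty ∧ W ⊆ V ∩ Ω ∧
    IsOpen V ∧ IsConnected V ∧ ¬ V ⊆ Ω ∧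
    ∀ f : EuclideanSpace ℂ (Fin n) → ℂ, DifferentiableOn ℂ f Ω →
      ∃ g : EuclideanSpace ℂ (Fin n) → ℂ, DifferentiableOn ℂ g V ∧ Set.EqOn f g W

/-!
The proof is the Hartogs-type splitting argument for `∂̄`. Let `Ω` be bounded, connected and open in
`ℂⁿ`, `n ≥ 2`, and suppose that `∂Ω` is the disjoint union of nonempty closed sets `A` and `B`.
Choose a smooth `χ` equal to `1` near `A` and to `0` near `B`, and let `f` be holomorphic on `Ω`.
The form `f ∂̄χ`, extended by zero off `Ω`, is `C¹`, compactly supported and `∂̄`-closed. Integrating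
it against the Cauchy kernel along the complex lines in one direction `e` gives `u` with
`∂̄u = f ∂̄χ` (`exists_dbar_eq_of_closed`), and `u` vanishes at every point whose line in direction
`e` misses the support of the form. So `χ f - u` is holomorphic on `Ω`, and `u` itself is holomorphic
near `A` and near `B`.

Let `l` be a nonzero linear functional killing `e` (here `n ≥ 2` is used) and let `p` maximize
`Re l` on the closure of `Ω`; say `p ∈ A`. Lines in direction `e` through points with
`Re l > Re l(p)` miss `Ω`, so `u` vanishes on an open set reaching `p`, hence on a whole ball
around `p`. There `χ = 1`, thus `f = χ f - u` near `p`, and by the identity theorem on all of `Ω`.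
Near a point `b ∈ B`, where `χ = 0`, this reads `f = -u`: every `f` extends across `b`, to a ball
independent of `f` (`exists_extension_across_ball`), and `Ω` is not a domain of holomorphy.

Besides this, the file contains the two facts on holomorphic functions of several variables that
are used, namely that they are `C¹` and satisfy the identity theorem; both are reduced to complex
lines.
-/

open Metric Set Filter Topology MeasureTheory
open scoped Interval

/-! ### Holomorphic functions of several variables -/

section Holomorphic

variable {E : Type*} [NormedAddCommGroup E] [NormedSpace ℂ E]

theorem differentiableAt_complex_line (z v : E) (t : ℂ) :
    DifferentiableAt ℂ (fun s : ℂ => z + s • v) t := by fun_prop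

/-- Cauchy's estimate for the Fréchet derivative. -/
theorem norm_fderiv_le_of_forall_mem_ball {h : E → ℂ} {z : E} {r C : ℝ} (hr : 0 < r)
    (hC : 0 ≤ C) (hd : DifferentiableOn ℂ h (ball z r)) (hb : ∀ w ∈ ball z r, ‖h w‖ ≤ C) :
    ‖fderiv ℂ h z‖ ≤ 2 * C / r := by
  have hdz : DifferentiableAt ℂ h z := hd.differentiableAt (ball_mem_nhds z hr)
  refine ContinuousLinearMap.opNorm_le_bound _ (by positivity) fun v => ?_
  rcases eq_or_ne v 0 with rfl | hv
  · simp
  have hv' : 0 < ‖v‖ := norm_pos_iff.2 hv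
  set ρ : ℝ := r / (2 * ‖v‖) with hρ
  have hρ0 : 0 < ρ := by positivity
  have hmem : ∀ t ∈ closedBall (0 : ℂ) ρ, z + t • v ∈ ball z r := by
    intro t ht
    rw [mem_closedBall_zero_iff] at ht
    rw [mem_ball, dist_eq_norm, add_sub_cancel_left, norm_smul]
    calc ‖t‖ * ‖v‖ ≤ ρ * ‖v‖ := by gcongr
      _ = r / 2 := by rw [hρ]; field_simp
      _ < r := by linarith
  have hline : HasDerivAt (fun t : ℂ => z + t • v) v 0 := by
    simpa using ((hasDerivAt_id (0 : ℂ)).smul_const v).const_add z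
  have hder : HasDerivAt (fun t : ℂ => h (z + t • v)) (fderiv ℂ h z v) 0 := by
    have h0 : HasFDerivAt h (fderiv ℂ h z) (z + (0 : ℂ) • v) := by simpa using hdz.hasFDerivAt
    exact h0.comp_hasDerivAt (0 : ℂ) hline
  have hdiff : DiffContOnCl ℂ (fun t : ℂ => h (z + t • v)) (ball 0 ρ) := by
    apply DifferentiableOn.diffContOnCl
    rw [closure_ball _ hρ0.ne']
    exact hd.comp (fun t _ => (differentiableAt_complex_line z v t).differentiableWithinAt) hmem
  have := Complex.norm_deriv_le_of_forall_mem_sphere_norm_le hρ0 hdiff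
    (fun t ht => hb _ (hmem t (sphere_subset_closedBall ht)))
  rw [hder.deriv] at this
  calc ‖fderiv ℂ h z v‖ ≤ C / ρ := this
    _ = 2 * C / r * ‖v‖ := by rw [hρ]; field_simp

/-- The derivative of a holomorphic function is continuous: Cauchy's estimate is applied to the
difference of `f` and a small translate of `f`, which is uniformly small on a compact ball. -/
theorem DifferentiableOn.continuousOn_fderiv_complex [FiniteDimensional ℂ E] {f : E → ℂ}
    {U : Set E} (hU : IsOpen U) (hf : DifferentiableOn ℂ f U) :
    ContinuousOn (fderiv ℂ f) U := by
  have : ProperSpace E := FiniteDimensional.proper ℂ E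
  intro z₀ hz₀
  refine ContinuousAt.continuousWithinAt ?_
  obtain ⟨r, hr, hrU⟩ := nhds_basis_closedBall.mem_iff.1 (hU.mem_nhds hz₀)
  have huc : UniformContinuousOn f (closedBall z₀ r) :=
    (isCompact_closedBall z₀ r).uniformContinuousOn_of_continuous (hf.continuousOn.mono hrU)
  rw [Metric.uniformContinuousOn_iff_le] at huc
  rw [Metric.continuousAt_iff']
  intro ε hε
  obtain ⟨δ, hδ, H⟩ := huc (ε * r / 8) (by positivity)
  filter_upwards [ball_mem_nhds z₀ (lt_min hδ (half_pos hr))] with z hz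
  rw [mem_ball, lt_min_iff, dist_eq_norm] at hz
  have hsh : ∀ w ∈ ball z₀ (r / 2), w + (z - z₀) ∈ closedBall z₀ r := by
    intro w hw
    rw [mem_ball, dist_eq_norm] at hw
    rw [mem_closedBall, dist_eq_norm, show w + (z - z₀) - z₀ = (w - z₀) + (z - z₀) by abel]
    exact (norm_add_le _ _).trans (by linarith [hz.2])
  have hsub : ball z₀ (r / 2) ⊆ closedBall z₀ r :=
    ball_subset_closedBall.trans (closedBall_subset_closedBall (by linarith))
  have hd1 : DifferentiableOn ℂ (fun w => f (w + (z - z₀))) (ball z₀ (r / 2)) :=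
    hf.comp (by fun_prop) fun w hw => hrU (hsh w hw)
  have hd2 : DifferentiableOn ℂ f (ball z₀ (r / 2)) := hf.mono (hsub.trans hrU)
  have hnb : ball z₀ (r / 2) ∈ 𝓝 z₀ := ball_mem_nhds _ (half_pos hr)
  have key := norm_fderiv_le_of_forall_mem_ball (h := fun w => f (w + (z - z₀)) - f w)
    (half_pos hr) (C := ε * r / 8) (by positivity) (hd1.sub hd2) (fun w hw => by
      rw [← dist_eq_norm]
      refine H _ (hsh w hw) _ (hsub hw) ?_
      rw [dist_eq_norm, add_sub_cancel_left]
      exact hz.1.le)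
  rw [fderiv_fun_sub (hd1.differentiableAt hnb) (hd2.differentiableAt hnb),
    fderiv_comp_add_right, add_sub_cancel] at key
  rw [dist_eq_norm]
  refine key.trans_lt ?_
  have : 2 * (ε * r / 8) / (r / 2) = ε / 2 := by field_simp; norm_num
  rw [this]; linarith

theorem DifferentiableOn.contDiffOn_one_complex [FiniteDimensional ℂ E] {f : E → ℂ}
    {U : Set E} (hU : IsOpen U) (hf : DifferentiableOn ℂ f U) : ContDiffOn ℂ 1 f U := by
  rw [show (1 : WithTop ℕ∞) = 0 + 1 by norm_num, contDiffOn_succ_iff_fderiv_of_isOpen hU]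
  exact ⟨hf, by simp, contDiffOn_zero.2 (hf.continuousOn_fderiv_complex hU)⟩

theorem DifferentiableOn.eqOn_zero_of_convex_complex {f : E → ℂ} {U : Set E} (hU : IsOpen U)
    (hc : Convex ℝ U) (hf : DifferentiableOn ℂ f U) {a : E} (ha : a ∈ U) (h0 : f =ᶠ[𝓝 a] 0) :
    EqOn f 0 U := by
  intro w hw
  have hcont : Continuous fun t : ℂ => a + t • (w - a) := by fun_prop
  set S : Set ℂ := (fun t : ℂ => a + t • (w - a)) ⁻¹' U
  have hS : IsOpen S := hU.preimage hcont
  have hSc : Convex ℝ S := by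
    intro s hs t ht c d hc0 hd0 hcd
    have := hc hs ht hc0 hd0 hcd
    have e : c • (a + s • (w - a)) + d • (a + t • (w - a))
        = a + (c • s + d • t) • (w - a) := by
      have ha' : c • a + d • a = a := by rw [← add_smul, hcd, one_smul]
      rw [smul_add, smul_add, add_smul, smul_assoc, smul_assoc, add_add_add_comm, ha']
    simpa only [S, mem_preimage, e] using this
  have hg : AnalyticOnNhd ℂ (fun t : ℂ => f (a + t • (w - a))) S :=
    (hf.comp (fun t _ => (differentiableAt_complex_line a (w - a) t).differentiableWithinAt)
      fun t ht => ht).analyticOnNhd hS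
  have h0' : (fun t : ℂ => f (a + t • (w - a))) =ᶠ[𝓝 0] 0 := by
    have : Tendsto (fun t : ℂ => a + t • (w - a)) (𝓝 0) (𝓝 a) := by
      simpa using hcont.tendsto 0
    exact this.eventually h0
  have := hg.eqOn_zero_of_preconnected_of_eventuallyEq_zero hSc.isPreconnected
    (z₀ := 0) (by simpa [S] using ha) h0' (show (1 : ℂ) ∈ S by simpa [S] using hw)
  simpa using this

theorem DifferentiableOn.eqOn_zero_of_isPreconnected_complex {f : E → ℂ} {U : Set E}
    (hU : IsOpen U) (hc : IsPreconnected U) (hf : DifferentiableOn ℂ f U) {a : E} (ha : a ∈ U)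
    (h0 : f =ᶠ[𝓝 a] 0) : EqOn f 0 U := by
  have hsub : U ⊆ {z | f =ᶠ[𝓝 z] 0} := by
    refine hc.subset_of_closure_inter_subset isOpen_setOfPred_eventually_nhds ⟨a, ha, h0⟩ ?_
    rintro z ⟨hzc, hzU⟩
    obtain ⟨r, hr, hrU⟩ := Metric.isOpen_iff.1 hU z hzU
    obtain ⟨y, hy, hyr⟩ := Metric.mem_closure_iff.1 hzc r hr
    have := (hf.mono hrU).eqOn_zero_of_convex_complex isOpen_ball (convex_ball z r)
      (mem_ball'.2 hyr) hy
    exact this.eventuallyEq_of_mem (ball_mem_nhds z hr)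
  exact fun z hz => (hsub hz).self_of_nhds

end Holomorphic

/-! ### The `∂̄` operator -/

section Dbar

variable {E : Type*} [NormedAddCommGroup E] [NormedSpace ℂ E]

/-- The value on the vector `v` of the `∂̄`-derivative of `φ` at `z`, that is, twice the antilinear
part `Dφ(v) + i Dφ(i v)` of the real derivative; the usual factor `1 / 2` is left out. -/
noncomputable def dbar (φ : E → ℂ) (z v : E) : ℂ :=
  fderiv ℝ φ z v + Complex.I * fderiv ℝ φ z (Complex.I • v)

theorem dbar_of_differentiableAt_complex {φ : E → ℂ} {z : E} (h : DifferentiableAt ℂ φ z)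
    (v : E) : dbar φ z v = 0 := by
  have : fderiv ℝ φ z = (fderiv ℂ φ z).restrictScalars ℝ :=
    (h.hasFDerivAt.restrictScalars ℝ).fderiv
  rw [dbar, this]
  simp only [ContinuousLinearMap.coe_restrictScalars', map_smul, smul_eq_mul]
  linear_combination (fderiv ℂ φ z v) * Complex.I_mul_I

theorem map_complex_smul (L : E →L[ℝ] ℂ) (c : ℂ) (v : E) :
    L (c • v) = c.re * L v + c.im * L (Complex.I • v) := by
  have : c • v = c.re • v + c.im • (Complex.I • v) := by
    conv_lhs => rw [← Complex.re_add_im c]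
    rw [add_smul, mul_smul, Complex.coe_smul, Complex.coe_smul]
  rw [this, map_add, map_smul, map_smul]; simp

/-- The Cauchy–Riemann equations imply complex differentiability. -/
theorem differentiableAt_complex_of_dbar_eq_zero {φ : E → ℂ} {z : E}
    (h : DifferentiableAt ℝ φ z) (h0 : ∀ v, dbar φ z v = 0) : DifferentiableAt ℂ φ z := by
  rw [differentiableAt_iff_restrictScalars ℝ h]
  have hI : ∀ v, fderiv ℝ φ z (Complex.I • v) = Complex.I * fderiv ℝ φ z v := by
    intro v
    have := h0 v
    rw [dbar] at this
    linear_combination (-Complex.I) * this + fderiv ℝ φ z (Complex.I • v) * Complex.I_mul_I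
  refine ⟨{ toFun := fderiv ℝ φ z, map_add' := map_add _, map_smul' := fun c v => ?_,
            cont := (fderiv ℝ φ z).continuous }, rfl⟩
  rw [map_complex_smul, hI, RingHom.id_apply, smul_eq_mul]
  conv_rhs => rw [← Complex.re_add_im c]
  ring

theorem dbar_complex_smul (φ : E → ℂ) (z : E) (c : ℂ) (v : E) :
    dbar φ z (c • v) = (starRingEnd ℂ) c * dbar φ z v := by
  rw [dbar, dbar, smul_smul, map_complex_smul, map_complex_smul _ (Complex.I * c)]
  have : (starRingEnd ℂ) c = c.re - c.im * Complex.I := by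
    apply Complex.ext <;> simp
  rw [this]
  simp only [Complex.mul_re, Complex.I_re, Complex.I_im, Complex.mul_im]
  push_cast
  linear_combination (c.im * fderiv ℝ φ z (Complex.I • v)) * Complex.I_mul_I

theorem dbar_mul {φ ψ : E → ℂ} {z : E} (hφ : DifferentiableAt ℝ φ z)
    (hψ : DifferentiableAt ℝ ψ z) (v : E) :
    dbar (fun w => φ w * ψ w) z v = φ z * dbar ψ z v + dbar φ z v * ψ z := by
  simp only [dbar, fderiv_fun_mul hφ hψ, add_apply, smul_apply, smul_eq_mul]
  ring

theorem dbar_sub {φ ψ : E → ℂ} {z : E} (hφ : DifferentiableAt ℝ φ z)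
    (hψ : DifferentiableAt ℝ ψ z) (v : E) :
    dbar (fun w => φ w - ψ w) z v = dbar φ z v - dbar ψ z v := by
  simp only [dbar, fderiv_fun_sub hφ hψ, sub_apply]
  ring

theorem Filter.EventuallyEq.dbar_eq {φ ψ : E → ℂ} {z : E} (h : φ =ᶠ[𝓝 z] ψ) (v : E) :
    dbar φ z v = dbar ψ z v := by
  rw [dbar, dbar, h.fderiv_eq]

theorem dbar_of_eventuallyEq_const {φ : E → ℂ} {z : E} {c : ℂ} (h : φ =ᶠ[𝓝 z] fun _ => c)
    (v : E) : dbar φ z v = 0 := by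
  rw [h.dbar_eq, dbar]; simp

/-- `∂̄ ∂̄ = 0`, from the symmetry of the second derivative. -/
theorem dbar_dbar_comm {χ : E → ℂ} (hχ : ContDiff ℝ 2 χ) (z v w : E) :
    dbar (fun y => dbar χ y v) z w = dbar (fun y => dbar χ y w) z v := by
  have hD : DifferentiableAt ℝ (fderiv ℝ χ) z :=
    (hχ.fderiv_right (m := 1) (by norm_num)).differentiable (by norm_num) z
  have hs : IsSymmSndFDerivAt ℝ χ z := hχ.contDiffAt.isSymmSndFDerivAt (by simp)
  have key : ∀ v w : E, fderiv ℝ (fun y => dbar χ y v) z w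
      = fderiv ℝ (fderiv ℝ χ) z w v + Complex.I * fderiv ℝ (fderiv ℝ χ) z w (Complex.I • v) := by
    intro v w
    have h1 : ∀ v : E, HasFDerivAt (fun y => fderiv ℝ χ y v)
        ((fderiv ℝ (fderiv ℝ χ) z).flip v) z := fun v => by
      simpa using hD.hasFDerivAt.clm_apply (hasFDerivAt_const v z)
    have := (h1 v).add ((h1 (Complex.I • v)).const_mul Complex.I)
    have h2 := this.fderiv
    simp only [dbar]
    erw [h2]
    simp
  simp only [dbar] at key ⊢
  rw [key, key, key, key, hs.eq w v, hs.eq w (Complex.I • v), hs.eq (Complex.I • w) v,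
    hs.eq (Complex.I • w) (Complex.I • v)]
  ring

theorem contDiff_dbar {χ : E → ℂ} (hχ : ContDiff ℝ 2 χ) (v : E) :
    ContDiff ℝ 1 fun y => dbar χ y v := by
  have := hχ.fderiv_right (m := 1) (by norm_num)
  simp only [dbar]
  fun_prop

end Dbar

/-! ### The Cauchy transform along complex lines and the `∂̄` equation -/

section CauchyTransform

variable {E : Type*} [NormedAddCommGroup E] [NormedSpace ℂ E]

/-- The Cauchy–Pompeiu formula on the line `z + ℂ e`, for a function that vanishes on the circle of
radius `T`. It is written in polar coordinates, where the Jacobian `r` cancels the modulus of the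
Cauchy kernel and the integrand has no singularity. -/
theorem integral_exp_mul_dbar {φ : E → ℂ} (hφ : ContDiff ℝ 1 φ) (z e : E) (T : ℝ)
    (h0 : ∀ θ : ℝ, φ (z + (T * Complex.exp (θ * Complex.I)) • e) = 0) :
    ∫ θ : ℝ in (0 : ℝ)..2 * Real.pi, ∫ r : ℝ in (0 : ℝ)..T, Complex.exp (-(θ * Complex.I)) *
      dbar φ (z + (r * Complex.exp (θ * Complex.I)) • e) e = -(2 * Real.pi) * φ z := by
  have hdiff : Differentiable ℝ φ := hφ.differentiable (by norm_num)
  have hD : Continuous (fderiv ℝ φ) := hφ.continuous_fderiv (by norm_num)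
  -- `A` is the radial derivative of `φ (z + r exp(iθ) e)` and `r * B` the angular one.
  set A : ℝ → ℝ → ℂ := fun θ r =>
    fderiv ℝ φ (z + (r * Complex.exp (θ * Complex.I)) • e) (Complex.exp (θ * Complex.I) • e)
    with hA
  set B : ℝ → ℝ → ℂ := fun θ r =>
    fderiv ℝ φ (z + (r * Complex.exp (θ * Complex.I)) • e)
      (Complex.I • Complex.exp (θ * Complex.I) • e) with hB
  have hAc : Continuous (Function.uncurry A) := by
    simp only [hA, Function.uncurry_def]; fun_prop
  have hBc : Continuous (Function.uncurry B) := by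
    simp only [hB, Function.uncurry_def]; fun_prop
  have hAB : ∀ θ r : ℝ, Complex.exp (-(θ * Complex.I)) *
      dbar φ (z + (r * Complex.exp (θ * Complex.I)) • e) e = A θ r + Complex.I * B θ r := by
    intro θ r
    rw [hA, hB, ← dbar, dbar_complex_smul, ← Complex.exp_conj]
    simp
  have hAint : ∀ θ, ∫ r in (0 : ℝ)..T, A θ r = -φ z := by
    intro θ
    have hder : ∀ r ∈ uIcc 0 T, HasDerivAt
        (fun r : ℝ => φ (z + (r * Complex.exp (θ * Complex.I)) • e)) (A θ r) r := by
      intro r _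
      have h1 : HasDerivAt (fun r : ℝ => z + ((r : ℂ) * Complex.exp (θ * Complex.I)) • e)
          (Complex.exp (θ * Complex.I) • e) r := by
        simpa using (((hasDerivAt_id r).ofReal_comp.mul_const
          (Complex.exp (θ * Complex.I))).smul_const e).const_add z
      exact (hdiff _).hasFDerivAt.comp_hasDerivAt r h1
    rw [intervalIntegral.integral_eq_sub_of_hasDerivAt hder
      ((hAc.comp (by fun_prop : Continuous fun r : ℝ => (θ, r))).intervalIntegrable _ _), h0]
    simp
  have hBint : ∀ r : ℝ, r ≠ 0 → ∫ θ in (0 : ℝ)..2 * Real.pi, B θ r = 0 := by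
    intro r hr
    have hder : ∀ θ ∈ uIcc 0 (2 * Real.pi), HasDerivAt
        (fun θ : ℝ => φ (z + (r * Complex.exp (θ * Complex.I)) • e)) (r * B θ r) θ := by
      intro θ _
      have h1 : HasDerivAt (fun θ : ℝ => z + ((r : ℂ) * Complex.exp (θ * Complex.I)) • e)
          (r • Complex.I • Complex.exp (θ * Complex.I) • e) θ := by
        have h2 : HasDerivAt (fun θ : ℝ => Complex.exp (θ * Complex.I))
            (Complex.exp (θ * Complex.I) * Complex.I) θ := by
          simpa using ((hasDerivAt_id θ).ofReal_comp.mul_const Complex.I).cexp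
        convert ((h2.const_mul (r : ℂ)).smul_const e).const_add z using 1
        rw [← Complex.coe_smul, smul_smul, smul_smul]
        ring_nf
      have := (hdiff (z + ((r : ℂ) * Complex.exp (θ * Complex.I)) • e)).hasFDerivAt.comp_hasDerivAt
        θ h1
      rw [map_smul, Complex.real_smul] at this
      exact this
    have hi := intervalIntegral.integral_eq_sub_of_hasDerivAt hder
      ((continuous_const.mul
        (hBc.comp (by fun_prop : Continuous fun θ : ℝ => (θ, r)))).intervalIntegrable _ _)
    rw [intervalIntegral.integral_const_mul] at hi
    have hr' : (r : ℂ) ≠ 0 := by exact_mod_cast hr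
    refine (mul_eq_zero.1 (hi.trans ?_)).resolve_left hr'
    simp
  have hsplit : ∀ θ : ℝ, ∫ r in (0 : ℝ)..T, (A θ r + Complex.I * B θ r)
      = -φ z + Complex.I * ∫ r in (0 : ℝ)..T, B θ r := by
    intro θ
    rw [intervalIntegral.integral_add, hAint, intervalIntegral.integral_const_mul]
    · exact (hAc.comp (by fun_prop : Continuous fun r : ℝ => (θ, r))).intervalIntegrable _ _
    · exact (continuous_const.mul
        (hBc.comp (by fun_prop : Continuous fun r : ℝ => (θ, r)))).intervalIntegrable _ _
  simp_rw [hAB, hsplit]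
  have hBi : Continuous fun θ => ∫ r in (0 : ℝ)..T, B θ r :=
    intervalIntegral.continuous_parametric_intervalIntegral_of_continuous' hBc 0 T
  rw [intervalIntegral.integral_add (by simp)
      ((continuous_const.fun_mul hBi).intervalIntegrable _ _),
    intervalIntegral.integral_const_mul, intervalIntegral_intervalIntegral_swap]
  · have : ∫ r in (0 : ℝ)..T, ∫ θ in (0 : ℝ)..2 * Real.pi, B θ r = 0 := by
      apply intervalIntegral.integral_zero_ae
      have : ∀ᵐ r : ℝ, r ≠ 0 := by simp [ae_iff]
      filter_upwards [this] with r hr _ using hBint r hr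
    rw [this]
    simp
  · exact (hBc.continuousOn.integrableOn_compact
      (isCompact_uIcc.prod isCompact_uIcc)).mono_set
        (prod_mono uIoc_subset_uIcc uIoc_subset_uIcc)

theorem hasFDerivAt_intervalIntegral_of_continuous {G : E → ℝ → ℂ} {G' : E → ℝ → E →L[ℝ] ℂ}
    {C : ℝ} (a b : ℝ) (hG : ∀ x, Continuous (G x)) (hG' : ∀ x, Continuous (G' x))
    (hC : ∀ x t, t ∈ Ι a b → ‖G' x t‖ ≤ C) (hd : ∀ x t, HasFDerivAt (fun y => G y t) (G' x t) x)
    (x : E) : HasFDerivAt (fun y => ∫ t in a..b, G y t) (∫ t in a..b, G' x t) x :=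
  intervalIntegral.hasFDerivAt_integral_of_dominated_of_fderiv_le (s := univ) (bound := fun _ => C)
    univ_mem (Eventually.of_forall fun y => (hG y).aestronglyMeasurable)
    ((hG x).intervalIntegrable _ _) (hG' x).aestronglyMeasurable
    (Eventually.of_forall fun t ht y _ => hC y t ht) (by simp)
    (Eventually.of_forall fun t _ y _ => hd y t)

theorem hasFDerivAt_cauchyTransform [FiniteDimensional ℂ E] {φ : E → ℂ} (hφ : ContDiff ℝ 1 φ)
    (hc : HasCompactSupport φ) (e : E) (T : ℝ) (z : E) :
    HasFDerivAt (fun z => ∫ θ : ℝ in (0 : ℝ)..2 * Real.pi, ∫ r : ℝ in (0 : ℝ)..T,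
        Complex.exp (-(θ * Complex.I)) * φ (z + (r * Complex.exp (θ * Complex.I)) • e))
      (∫ θ : ℝ in (0 : ℝ)..2 * Real.pi, ∫ r : ℝ in (0 : ℝ)..T,
        Complex.exp (-(θ * Complex.I)) • fderiv ℝ φ (z + (r * Complex.exp (θ * Complex.I)) • e))
      z := by
  have hdiff : Differentiable ℝ φ := hφ.differentiable (by norm_num)
  have hφc : Continuous φ := hφ.continuous
  have hD : Continuous (fderiv ℝ φ) := hφ.continuous_fderiv (by norm_num)
  obtain ⟨C, hC⟩ := (hc.fderiv (𝕜 := ℝ)).exists_bound_of_continuous hD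
  have hnorm : ∀ (θ r : ℝ) (z : E), ‖Complex.exp (-(θ * Complex.I)) •
      fderiv ℝ φ (z + (r * Complex.exp (θ * Complex.I)) • e)‖ ≤ C := by
    intro θ r z
    have : ‖Complex.exp (-(θ * Complex.I))‖ = 1 := by
      rw [← neg_mul, ← Complex.ofReal_neg, Complex.norm_exp_ofReal_mul_I]
    rw [norm_smul, this, one_mul]
    exact hC _
  refine hasFDerivAt_intervalIntegral_of_continuous (C := C * |T - 0|)
    (G := fun z θ => ∫ r : ℝ in (0 : ℝ)..T,
      Complex.exp (-(θ * Complex.I)) * φ (z + (r * Complex.exp (θ * Complex.I)) • e))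
    (G' := fun z θ => ∫ r : ℝ in (0 : ℝ)..T,
      Complex.exp (-(θ * Complex.I)) • fderiv ℝ φ (z + (r * Complex.exp (θ * Complex.I)) • e))
    _ _ ?_ ?_ ?_ ?_ z
  · intro x
    refine intervalIntegral.continuous_parametric_intervalIntegral_of_continuous' ?_ _ _
    fun_prop
  · intro x
    refine intervalIntegral.continuous_parametric_intervalIntegral_of_continuous' ?_ _ _
    fun_prop
  · exact fun x θ _ => intervalIntegral.norm_integral_le_of_norm_le_const fun r _ => hnorm θ r x
  · intro x θ
    refine hasFDerivAt_intervalIntegral_of_continuous (C := C)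
      (G := fun z r =>
        Complex.exp (-(θ * Complex.I)) * φ (z + (r * Complex.exp (θ * Complex.I)) • e))
      (G' := fun z r =>
        Complex.exp (-(θ * Complex.I)) • fderiv ℝ φ (z + (r * Complex.exp (θ * Complex.I)) • e))
      _ _ ?_ ?_ ?_ ?_ x
    · intro x; fun_prop
    · intro x; fun_prop
    · exact fun x r _ => hnorm θ r x
    · intro x r
      have := (hdiff (x + ((r : ℂ) * Complex.exp (θ * Complex.I)) • e)).hasFDerivAt.comp x
        ((hasFDerivAt_id (𝕜 := ℝ) x).add_const (((r : ℂ) * Complex.exp (θ * Complex.I)) • e))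
      simpa using this.const_mul (Complex.exp (-(θ * Complex.I)))

theorem dbar_cauchyTransform [FiniteDimensional ℂ E] {φ : E → ℂ} (hφ : ContDiff ℝ 1 φ)
    (hc : HasCompactSupport φ) (e : E) (T : ℝ) (z v : E) :
    dbar (fun z => ∫ θ : ℝ in (0 : ℝ)..2 * Real.pi, ∫ r : ℝ in (0 : ℝ)..T,
        Complex.exp (-(θ * Complex.I)) * φ (z + (r * Complex.exp (θ * Complex.I)) • e)) z v
      = ∫ θ : ℝ in (0 : ℝ)..2 * Real.pi, ∫ r : ℝ in (0 : ℝ)..T,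
        Complex.exp (-(θ * Complex.I)) *
          dbar φ (z + (r * Complex.exp (θ * Complex.I)) • e) v := by
  have hD : Continuous (fderiv ℝ φ) := hφ.continuous_fderiv (by norm_num)
  have happ : ∀ v : E, (∫ θ : ℝ in (0 : ℝ)..2 * Real.pi, ∫ r : ℝ in (0 : ℝ)..T,
      Complex.exp (-(θ * Complex.I)) •
        fderiv ℝ φ (z + (r * Complex.exp (θ * Complex.I)) • e)) v
      = ∫ θ : ℝ in (0 : ℝ)..2 * Real.pi, ∫ r : ℝ in (0 : ℝ)..T,
      Complex.exp (-(θ * Complex.I)) *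
        fderiv ℝ φ (z + (r * Complex.exp (θ * Complex.I)) • e) v := by
    intro v
    rw [ContinuousLinearMap.intervalIntegral_apply]
    · congr 1
      funext θ
      rw [ContinuousLinearMap.intervalIntegral_apply]
      · rfl
      · exact Continuous.intervalIntegrable (by fun_prop) _ _
    · refine Continuous.intervalIntegrable ?_ _ _
      refine intervalIntegral.continuous_parametric_intervalIntegral_of_continuous' ?_ _ _
      fun_prop
  have hcont : ∀ v : E, Continuous fun θ : ℝ => ∫ r : ℝ in (0 : ℝ)..T,
      Complex.exp (-(θ * Complex.I)) *
        fderiv ℝ φ (z + (r * Complex.exp (θ * Complex.I)) • e) v := by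
    intro v
    refine intervalIntegral.continuous_parametric_intervalIntegral_of_continuous' ?_ _ _
    fun_prop
  rw [dbar, (hasFDerivAt_cauchyTransform hφ hc e T z).fderiv, happ, happ,
    ← intervalIntegral.integral_const_mul, ← intervalIntegral.integral_add
      ((hcont _).intervalIntegrable _ _) ((continuous_const.fun_mul (hcont _)).intervalIntegrable _ _)]
  congr 1
  funext θ
  rw [← intervalIntegral.integral_const_mul, ← intervalIntegral.integral_add
      (Continuous.intervalIntegrable (by fun_prop) _ _)
      (Continuous.intervalIntegrable (by fun_prop) _ _)]
  congr 1
  funext r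
  rw [dbar]; ring

/-- Solution of `∂̄u = F` on a ball of radius `R'`, for a `C¹`, compactly supported, `∂̄`-closed
`(0, 1)`-form `F`, whose value on the vector `v` at `z` is `F v z`. The solution vanishes wherever the
line in direction `e` misses the support of `F e`. -/
theorem exists_dbar_eq_of_closed [FiniteDimensional ℂ E] {F : E → E → ℂ}
    (hF : ∀ v, ContDiff ℝ 1 (F v)) {R : ℝ} (hR : ∀ v z, R ≤ ‖z‖ → F v z = 0)
    (hcl : ∀ v w z, dbar (F v) z w = dbar (F w) z v) {e : E} (he : e ≠ 0) (R' : ℝ) :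
    ∃ u : E → ℂ, Differentiable ℝ u ∧ (∀ z v, ‖z‖ ≤ R' → dbar u z v = F v z) ∧
      ∀ z, (∀ c : ℂ, F e (z + c • e) = 0) → u z = 0 := by
  have : ProperSpace E := FiniteDimensional.proper ℂ E
  have hsupp : ∀ v, HasCompactSupport (F v) := fun v =>
    HasCompactSupport.intro (isCompact_closedBall (0 : E) R) fun z hz =>
      hR v z (by rw [mem_closedBall_zero_iff, not_le] at hz; exact hz.le)
  have he' : 0 < ‖e‖ := norm_pos_iff.2 he
  -- For `‖z‖ ≤ R'`, the circle of radius `T` in the line through `z` lies outside the ball of radius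
  -- `R`, where `F` vanishes.
  set T : ℝ := (|R| + |R'|) / ‖e‖ with hT
  have hT0 : 0 ≤ T := by positivity
  set w : E → ℂ := fun z => ∫ θ : ℝ in (0 : ℝ)..2 * Real.pi, ∫ r : ℝ in (0 : ℝ)..T,
        Complex.exp (-(θ * Complex.I)) * F e (z + (r * Complex.exp (θ * Complex.I)) • e) with hw
  have hwd : Differentiable ℝ w := fun z =>
    (hasFDerivAt_cauchyTransform (hF e) (hsupp e) e T z).differentiableAt
  refine ⟨fun z => (-(2 * Real.pi : ℂ)⁻¹) * w z, by fun_prop, ?_, ?_⟩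
  · intro z v hz
    have hconst : ∀ y : E, dbar (fun _ : E => (-(2 * Real.pi : ℂ)⁻¹)) z y = 0 := fun y =>
      dbar_of_eventuallyEq_const EventuallyEq.rfl y
    rw [dbar_mul (by fun_prop) (hwd z), hconst, zero_mul, add_zero, hw,
      dbar_cauchyTransform (hF e) (hsupp e)]
    -- Closedness turns `∂̄` of the component `F e` in direction `v` into `∂̄` of `F v` along the line,
    -- where the Cauchy–Pompeiu formula applies.
    simp_rw [hcl e v]
    rw [integral_exp_mul_dbar (hF v)]
    · have : (Real.pi : ℂ) ≠ 0 := by exact_mod_cast Real.pi_ne_zero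
      field_simp
    · intro θ
      apply hR
      have h1 : ‖((T : ℂ) * Complex.exp (θ * Complex.I)) • e‖ = |R| + |R'| := by
        rw [norm_smul, norm_mul, Complex.norm_exp_ofReal_mul_I, mul_one, Complex.norm_real,
          Real.norm_of_nonneg hT0, hT]
        field_simp
      have h2 := norm_sub_le_norm_add (((T : ℂ) * Complex.exp (θ * Complex.I)) • e) z
      rw [h1, add_comm _ z] at h2
      linarith [le_abs_self R, le_abs_self R']
  · intro z hz
    simp [hw, hz]

end CauchyTransform

/-! ### Extension across a part of the boundary -/

section Extension

variable {E : Type*} [NormedAddCommGroup E] [NormedSpace ℂ E] [FiniteDimensional ℂ E]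

theorem exists_contDiff_cutoff {A B : Set E} (hA : IsClosed A) (hB : IsClosed B)
    (hAB : Disjoint A B) : ∃ χ : E → ℂ, ContDiff ℝ 2 χ ∧
      (∀ z ∈ A, χ =ᶠ[𝓝 z] fun _ => 1) ∧ ∀ z ∈ B, χ =ᶠ[𝓝 z] fun _ => 0 := by
  have : ProperSpace E := FiniteDimensional.proper ℂ E
  obtain ⟨χ, h0, h1, -⟩ := exists_contMDiffMap_zero_one_nhds_of_isClosed (n := 2)
    (modelWithCornersSelf ℝ E) hB hA hAB.symm
  rw [eventually_nhdsSet_iff_forall] at h0 h1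
  refine ⟨fun z => (χ z : ℂ), Complex.ofRealCLM.contDiff.comp χ.contMDiff.contDiff,
    fun z hz => (h1 z hz).mono fun w hw => ?_, fun z hz => (h0 z hz).mono fun w hw => ?_⟩ <;>
  simp [hw]

/-- If the boundary of `Ω` splits into `A` and `B`, and `A` contains a point `p` maximizing over `Ω` the
real part of a linear functional that kills some nonzero vector, then all holomorphic functions on
`Ω` extend across the points of `B`, to a ball that does not depend on the function. -/
theorem exists_extension_across_ball {Ω A B : Set E} (hΩ : IsOpen Ω) (hconn : IsPreconnected Ω)
    (hbdd : Bornology.IsBounded Ω) (hA : IsClosed A) (hB : IsClosed B) (hAB : Disjoint A B)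
    (hfr : frontier Ω ⊆ A ∪ B) {l : E →L[ℂ] ℂ} (hl : l ≠ 0) {e : E} (he : e ≠ 0) (hle : l e = 0)
    {p : E} (hpΩ : p ∈ closure Ω) (hpA : p ∈ A) (hp : ∀ z ∈ Ω, (l z).re ≤ (l p).re)
    {b : E} (hbΩ : b ∈ closure Ω) (hbB : b ∈ B) :
    ∃ ε > 0, ∀ f : E → ℂ, DifferentiableOn ℂ f Ω → ∃ g : E → ℂ,
      DifferentiableOn ℂ g (ball b ε) ∧ EqOn f g (ball b ε ∩ Ω) := by
  classical
  obtain ⟨χ, hχ, hχA, hχB⟩ := exists_contDiff_cutoff hA hB hAB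
  have hχd : Differentiable ℝ χ := hχ.differentiable (by norm_num)
  obtain ⟨R, hR⟩ := hbdd.closure.subset_ball (0 : E)
  have key : ∀ {y : E} {c : ℂ}, (χ =ᶠ[𝓝 y] fun _ => c) →
      ∃ ε > 0, ε ≤ 1 ∧ ∀ z ∈ ball y ε, χ z = c := by
    intro y c h
    obtain ⟨ε, hε, H⟩ := Metric.eventually_nhds_iff_ball.1 h
    exact ⟨min ε 1, by positivity, min_le_right _ _,
      fun z hz => H z (ball_subset_ball (min_le_left _ _) hz)⟩
  obtain ⟨δ, hδ, hδ1, hχp⟩ := key (hχA p hpA)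
  obtain ⟨ε, hε, hε1, hχb⟩ := key (hχB b hbB)
  refine ⟨ε, hε, fun f hf => ?_⟩
  have hdbarχ : ∀ {y : E} {r : ℝ} {c : ℂ}, (∀ z ∈ ball y r, χ z = c) → ∀ z ∈ ball y r, ∀ v,
      dbar χ z v = 0 := fun H z hz v =>
    dbar_of_eventuallyEq_const (eventuallyEq_of_mem (isOpen_ball.mem_nhds hz) H) v
  -- `F` is `f ∂̄χ`, extended by zero off `Ω`: the values of `f` off `Ω` are arbitrary, and `∂̄χ` need not
  -- vanish in the exterior of `Ω`.
  set F : E → E → ℂ := fun v z => Ω.indicator f z * dbar χ z v with hFdef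
  have hFin : ∀ z ∈ Ω, ∀ v, F v =ᶠ[𝓝 z] fun y => f y * dbar χ y v := fun z hz v => by
    filter_upwards [hΩ.mem_nhds hz] with y hy
    simp [hFdef, hy]
  have hFout : ∀ z, z ∉ Ω → ∀ v, F v =ᶠ[𝓝 z] fun _ => 0 := by
    intro z hz v
    by_cases hzc : z ∈ closure Ω
    · have hconst : ∃ c : ℂ, χ =ᶠ[𝓝 z] fun _ => c := by
        rcases hfr (by rw [hΩ.frontier_eq]; exact ⟨hzc, hz⟩) with h | h
        exacts [⟨1, hχA z h⟩, ⟨0, hχB z h⟩]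
      obtain ⟨c, hc⟩ := hconst
      filter_upwards [hc.eventuallyEq_nhds] with y hy
      simp [hFdef, dbar_of_eventuallyEq_const hy]
    · filter_upwards [isClosed_closure.isOpen_compl.mem_nhds hzc] with y hy
      have : y ∉ Ω := fun h => hy (subset_closure h)
      simp [hFdef, this]
  have hfC : ContDiffOn ℝ 1 f Ω := (hf.contDiffOn_one_complex hΩ).restrict_scalars ℝ
  have hfd : ∀ z ∈ Ω, DifferentiableAt ℂ f z := fun z hz => hf.differentiableAt (hΩ.mem_nhds hz)
  have hF : ∀ v, ContDiff ℝ 1 (F v) := by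
    intro v
    rw [contDiff_iff_contDiffAt]
    intro z
    by_cases hz : z ∈ Ω
    · exact ((hfC.contDiffAt (hΩ.mem_nhds hz)).mul
        (contDiff_dbar hχ v).contDiffAt).congr_of_eventuallyEq (hFin z hz v)
    · exact contDiffAt_const.congr_of_eventuallyEq (hFout z hz v)
  have hcl : ∀ v w z, dbar (F v) z w = dbar (F w) z v := by
    intro v w z
    by_cases hz : z ∈ Ω
    · have h1 : ∀ v w, dbar (F v) z w = f z * dbar (fun y => dbar χ y v) z w := fun v w => by
        rw [(hFin z hz v).dbar_eq, dbar_mul ((hfd z hz).restrictScalars ℝ)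
          ((contDiff_dbar hχ v).differentiable (by norm_num) z),
          dbar_of_differentiableAt_complex (hfd z hz), zero_mul, add_zero]
      rw [h1, h1, dbar_dbar_comm hχ]
    · rw [dbar_of_eventuallyEq_const (hFout z hz v), dbar_of_eventuallyEq_const (hFout z hz w)]
  have hFR : ∀ v z, R ≤ ‖z‖ → F v z = 0 := by
    intro v z hz
    have : z ∉ Ω := fun h => by
      have := hR (subset_closure h)
      rw [mem_ball_zero_iff] at this
      linarith
    simp [hFdef, this]
  obtain ⟨u, hud, hu, hu0⟩ := exists_dbar_eq_of_closed hF hFR hcl he (R + 1)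
  have hnear : ∀ {y : E} {r : ℝ}, y ∈ closure Ω → r ≤ 1 → ∀ z ∈ ball y r, ‖z‖ ≤ R + 1 := by
    intro y r hy hr z hz
    have h1 := hR hy
    rw [mem_ball_zero_iff] at h1
    rw [mem_ball, dist_eq_norm] at hz
    have := norm_le_norm_add_norm_sub' z y
    linarith
  have huhol : ∀ {y : E} {r : ℝ} {c : ℂ}, y ∈ closure Ω → r ≤ 1 → (∀ z ∈ ball y r, χ z = c) →
      DifferentiableOn ℂ u (ball y r) := by
    intro y r c hy hr H z hz
    refine (differentiableAt_complex_of_dbar_eq_zero (hud z) fun v => ?_).differentiableWithinAt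
    rw [hu z v (hnear hy hr z hz), hFdef]
    simp [hdbarχ H z hz v]
  -- The half-space `Re l > Re l(p)`, on which `u` vanishes, meets the ball at `q = p + s x`.
  have hup : EqOn u 0 (ball p δ) := by
    obtain ⟨x, hx⟩ : ∃ x, l x = 1 := by
      obtain ⟨x, hx⟩ : ∃ x, l x ≠ 0 := by
        by_contra! h
        exact hl (ContinuousLinearMap.ext h)
      exact ⟨(l x)⁻¹ • x, by simp [hx]⟩
    have hx0 : 0 < ‖x‖ := norm_pos_iff.2 fun h => by simp [h] at hx
    set s : ℝ := δ / (2 * ‖x‖) with hs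
    have hs0 : 0 < s := by positivity
    have hq : p + (s : ℂ) • x ∈ ball p δ := by
      rw [mem_ball, dist_eq_norm, add_sub_cancel_left, norm_smul, Complex.norm_real,
        Real.norm_of_nonneg hs0.le]
      have : s * ‖x‖ = δ / 2 := by rw [hs]; field_simp
      linarith
    refine (huhol hpΩ hδ1 hχp).eqOn_zero_of_convex_complex isOpen_ball (convex_ball p δ) hq ?_
    have hopen : IsOpen {z : E | (l p).re < (l z).re} :=
      isOpen_lt continuous_const (by fun_prop)
    filter_upwards [hopen.mem_nhds (show (l p).re < (l (p + (s : ℂ) • x)).re by simp [hx, hs0])]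
      with z hz
    refine hu0 z fun c => ?_
    have : z + c • e ∉ Ω := fun h => by
      have := hp _ h
      simp only [map_add, map_smul, hle, smul_zero, add_zero] at this
      exact absurd hz (not_lt.2 this)
    simp [hFdef, this]
  -- Near `p`, where `χ = 1` and `u = 0`, the two holomorphic functions `f` and `χ f - u` agree.
  have hid : EqOn (fun z => f z - (χ z * f z - u z)) 0 Ω := by
    have hhol : DifferentiableOn ℂ (fun z => f z - (χ z * f z - u z)) Ω := by
      intro z hz
      have hfR : DifferentiableAt ℝ f z := (hfd z hz).restrictScalars ℝ
      refine ((hfd z hz).sub (differentiableAt_complex_of_dbar_eq_zero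
        (((hχd z).mul hfR).sub (hud z)) fun v => ?_)).differentiableWithinAt
      have hzR : ‖z‖ ≤ R + 1 := hnear (subset_closure hz) le_rfl z (mem_ball_self one_pos)
      have := dbar_sub ((hχd z).fun_mul hfR) (hud z) v
      rw [dbar_mul (hχd z) hfR, dbar_of_differentiableAt_complex (hfd z hz), hu z v hzR,
        (hFin z hz v).self_of_nhds] at this
      exact this.trans (by ring)
    obtain ⟨a, haΩ, ha⟩ := Metric.mem_closure_iff.1 hpΩ δ hδ
    refine hhol.eqOn_zero_of_isPreconnected_complex hΩ hconn haΩ ?_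
    filter_upwards [isOpen_ball.mem_nhds (mem_ball'.2 ha)] with z hz
    simp [hχp z hz, hup hz]
  refine ⟨fun z => -u z, (huhol hbΩ hε1 hχb).neg, fun z hz => ?_⟩
  have := hid hz.2
  simp only [hχb z hz.1, Pi.zero_apply] at this
  linear_combination this

end Extension

theorem theorem1 (n : ℕ) (hn : 2 ≤ n) (Ω : Set (EuclideanSpace ℂ (Fin n)))
    (hΩ : IsDomainOfHolomorphy Ω) (hconn : IsConnected Ω) (hbdd : Bornology.IsBounded Ω) :
    IsConnected (frontier Ω) := by
  obtain ⟨l, e, x, he0, hle, hx⟩ : ∃ (l : EuclideanSpace ℂ (Fin n) →L[ℂ] ℂ)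
      (e x : EuclideanSpace ℂ (Fin n)), e ≠ 0 ∧ l e = 0 ∧ l x = 1 :=
    ⟨EuclideanSpace.proj ⟨1, by lia⟩, EuclideanSpace.single ⟨0, by lia⟩ 1,
      EuclideanSpace.single ⟨1, by lia⟩ 1, by simp, by simp, by simp⟩
  have hl0 : l ≠ 0 := fun h => by simp [h] at hx
  have hcomp : IsCompact (closure Ω) := hbdd.isCompact_closure
  obtain ⟨p, hpc, hp⟩ := hcomp.exists_isMaxOn hconn.nonempty.closure
    (f := fun z => (l z).re) (by fun_prop)
  have hp' : ∀ z ∈ Ω, (l z).re ≤ (l p).re := fun z hz => hp (subset_closure hz)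
  -- `Re l` increases in the direction `x`, so its maximum is not attained in the open set `Ω`.
  have hpΩ : p ∉ Ω := by
    intro hpΩ
    have hc : Tendsto (fun t : ℝ => p + (t : ℂ) • x) (𝓝[>] 0) (𝓝 p) := by
      have : Continuous fun t : ℝ => p + (t : ℂ) • x := by fun_prop
      simpa using (this.tendsto 0).mono_left nhdsWithin_le_nhds
    obtain ⟨t, ht, ht0⟩ :=
      ((hc.eventually (hΩ.isOpen.mem_nhds hpΩ)).and self_mem_nhdsWithin).exists
    have := hp' _ ht
    simp only [map_add, map_smul, hx, smul_eq_mul, mul_one, Complex.add_re,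
      Complex.ofReal_re] at this
    linarith [show (0 : ℝ) < t from ht0]
  have hpf : p ∈ frontier Ω := by rw [hΩ.isOpen.frontier_eq]; exact ⟨hpc, hpΩ⟩
  refine ⟨⟨p, hpf⟩, ?_⟩
  have key : ∀ A B : Set (EuclideanSpace ℂ (Fin n)), IsClosed A → IsClosed B →
      frontier Ω ⊆ A ∪ B → frontier Ω ∩ (A ∩ B) = ∅ → p ∈ A → frontier Ω ⊆ A := by
    intro A B hA hB hAB hdisj hpA b hb
    by_contra hbA
    have hbB : b ∈ B := (hAB hb).resolve_left hbA
    have hbf := hb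
    rw [hΩ.isOpen.frontier_eq] at hbf
    obtain ⟨ε, hε, hext⟩ := exists_extension_across_ball hΩ.isOpen hconn.isPreconnected hbdd
      (A := frontier Ω ∩ A) (B := frontier Ω ∩ B)
      (isClosed_frontier.inter hA) (isClosed_frontier.inter hB)
      (by
        rw [Set.disjoint_iff_inter_eq_empty, ← hdisj]
        ext; simp only [mem_inter_iff]; tauto)
      (fun z hz => (hAB hz).imp (fun h => ⟨hz, h⟩) fun h => ⟨hz, h⟩)
      hl0 he0 hle hpc ⟨hpf, hpA⟩ hp' hbf.1 ⟨hb, hbB⟩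
    refine hΩ.not_extends ⟨ball b ε ∩ Ω, ball b ε, isOpen_ball.inter hΩ.isOpen, ?_, Subset.rfl,
      isOpen_ball, ?_, fun h => hbf.2 (h (mem_ball_self hε)), hext⟩
    · obtain ⟨a, haΩ, ha⟩ := Metric.mem_closure_iff.1 hbf.1 ε hε
      exact ⟨a, mem_ball'.2 ha, haΩ⟩
    · exact ⟨⟨b, mem_ball_self hε⟩, (convex_ball b ε).isPreconnected⟩
  rw [isPreconnected_iff_subset_of_disjoint_closed]
  intro A B hA hB hAB hdisj
  rcases hAB hpf with h | h
  · exact Or.inl (key A B hA hB hAB hdisj h)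
  · exact Or.inr (key B A hB hA (by rwa [union_comm]) (by rwa [inter_comm B A]) h)
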